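/- Let $\mathrm{MTL}$ be the monoidal t-norm based logic (over the connectives $\&,\wedge,\to,\bot$ and countably many variables) and let $L$ be an axiomatic extension of $\mathrm{MTL}$, i.e. a logic obtained from $\mathrm{MTL}$ by adding axiom schemata, with modus ponens as the only rule. An MTL-algebra is a bounded lattice $\langle A,\sqcap,\sqcup,0,1\rangle$ with a commutative monoid structure $\langle A,*,1\rangle$ and an operation $\Rightarrow$ such that $z*x\le y$ iff $z\le x\Rightarrow y$, and $(x\Rightarrow y)\sqcup(y\Rightarrow x)=1$. An $L$-algebra is an MTL-algebra in which every axiom of $L$ takes the value $1$ under every assignment; the $L$-algebras form the variety $\mathbb{L}$ corresponding to $L$. Say that - $L$ enjoys the single chain completeness (SCC) if there is a totally ordered $L$-algebra $\mathcal A$ such that, for every formula $\varphi$, $\vdash_L\varphi$ if and only if $\varphi$ takes the value $1$ under every assignment in $\mathcal A$; - $L$ enjoys the subdirect single chain completeness (subSCC) if there is a subdirectly irreducible $L$-algebra (the trivial algebra being counted as subdirectly irreducible) that is generic, i.e. generates the variety $\mathbb{L}$; - $L$ is $n$-contractive, for a positive integer $n$, if $\vdash_L\varphi^n\to\varphi^{n+1}$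 for every formula $\varphi$, where $\varphi^n=\varphi\,\&\cdots\&\,\varphi$ ($n$ factors). Suppose that $\mathbb{L}$ is locally finite, i.e. every finitely generated $L$-algebra is finite. Then $L$ is $n$-contractive for some positive integer $n$, and $L$ enjoys the SCC if and only if $L$ enjoys the subSCC. -/

import Mathlib

universe u

namespace MTL

/-- Formulas over the connectives `&`, `∧`, `→`, `⊥` and the variables `p₀, p₁, …`. -/
inductive Formula : Type
  | var : ℕ → Formula
  | bot : Formula
  | conj : Formula → Formula → Formula
  | meet : Formula → Formula → Formula
  | imp : Formula → Formula → Formula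

namespace Formula

/-- Simultaneous substitution of formulas for variables. -/
def subst (σ : ℕ → Formula) : Formula → Formula
  | var i => σ i
  | bot => bot
  | conj φ ψ => conj (φ.subst σ) (ψ.subst σ)
  | meet φ ψ => meet (φ.subst σ) (ψ.subst σ)
  | imp φ ψ => imp (φ.subst σ) (ψ.subst σ)

/-- The power `φⁿ = φ & ⋯ & φ` (`n` factors), with `φ⁰` the true formula `⊥ → ⊥`. -/
def pow (φ : Formula) : ℕ → Formula
  | 0 => imp bot bot
  | 1 => φ
  | n + 2 => conj (φ.pow (n + 1)) φ

end Formula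

open Formula in
/-- The axioms of the monoidal t-norm based logic MTL. -/
inductive MTLAxiom : Formula → Prop
  | a1 (φ ψ χ : Formula) : MTLAxiom (imp (imp φ ψ) (imp (imp ψ χ) (imp φ χ)))
  | a2 (φ ψ : Formula) : MTLAxiom (imp (conj φ ψ) φ)
  | a3 (φ ψ : Formula) : MTLAxiom (imp (conj φ ψ) (conj ψ φ))
  | a4 (φ ψ : Formula) : MTLAxiom (imp (meet φ ψ) φ)
  | a5 (φ ψ : Formula) : MTLAxiom (imp (meet φ ψ) (meet ψ φ))
  | a6 (φ ψ : Formula) : MTLAxiom (imp (conj φ (imp φ ψ)) (meet ψ φ))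
  | a7a (φ ψ χ : Formula) : MTLAxiom (imp (imp φ (imp ψ χ)) (imp (conj φ ψ) χ))
  | a7b (φ ψ χ : Formula) : MTLAxiom (imp (imp (conj φ ψ) χ) (imp φ (imp ψ χ)))
  | a8 (φ ψ χ : Formula) :
      MTLAxiom (imp (imp (imp φ ψ) χ) (imp (imp (imp ψ φ) χ) χ))
  | a9 (φ : Formula) : MTLAxiom (imp bot φ)

/-- An axiomatic extension of MTL, given by the set of axioms (read as schemata) added to MTL. -/
structure AxiomaticExtension where
  extraAxioms : Set Formula

/-- `L.Provable φ` is `⊢_L φ`: derivability from the axioms of MTL and the substitution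
instances of the additional axioms by modus ponens. -/
inductive AxiomaticExtension.Provable (L : AxiomaticExtension) : Formula → Prop
  | mtl {φ : Formula} : MTLAxiom φ → L.Provable φ
  | extra {φ : Formula} (σ : ℕ → Formula) : φ ∈ L.extraAxioms → L.Provable (φ.subst σ)
  | mp {φ ψ : Formula} : L.Provable φ → L.Provable (Formula.imp φ ψ) → L.Provable ψ

/-- FL_ew-algebras: bounded commutative integral residuated lattices. -/
class FLewAlgebra (A : Type u) extends Lattice A, BoundedOrder A, CommMonoid A where
  /-- the residuum `x ⇒ y` -/
  res : A → A → A
  one_eq_top : (1 : A) = ⊤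
  mul_le_iff_le_res : ∀ x y z : A, z * x ≤ y ↔ z ≤ res x y

/-- MTL-algebras: prelinear FL_ew-algebras. -/
class MTLAlgebra (A : Type u) extends FLewAlgebra A where
  prelinearity : ∀ x y : A, res x y ⊔ res y x = 1

/-- The value of a formula under an assignment. -/
def Formula.eval {A : Type u} [MTLAlgebra A] (v : ℕ → A) : Formula → A
  | .var i => v i
  | .bot => ⊥
  | .conj φ ψ => φ.eval v * ψ.eval v
  | .meet φ ψ => φ.eval v ⊓ ψ.eval v
  | .imp φ ψ => FLewAlgebra.res (φ.eval v) (ψ.eval v)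

/-- `φ` is valid in `A`: it takes the value `1` under every assignment. -/
def Valid (A : Type u) [MTLAlgebra A] (φ : Formula) : Prop :=
  ∀ v : ℕ → A, φ.eval v = 1

/-- The identity `s ≈ t` holds in `A`. Every term in the operations `*, ⇒, ⊓, ⊔, 0, 1` of
MTL-algebras is equivalent to a formula, since `1 = 0 ⇒ 0` and
`x ⊔ y = ((x ⇒ y) ⇒ y) ⊓ ((y ⇒ x) ⇒ x)`. -/
def SatisfiesIdentity (A : Type u) [MTLAlgebra A] (s t : Formula) : Prop :=
  ∀ v : ℕ → A, s.eval v = t.eval v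

/-- `A` is totally ordered. -/
def IsMTLChain (A : Type u) [MTLAlgebra A] : Prop :=
  ∀ x y : A, x ≤ y ∨ y ≤ x

/-- The equivalence relation `θ` is a congruence of the algebra `A`. -/
structure IsCongruence {A : Type u} [MTLAlgebra A] (θ : Setoid A) : Prop where
  mul : ∀ {a a' b b' : A}, θ a a' → θ b b' → θ (a * b) (a' * b')
  res : ∀ {a a' b b' : A}, θ a a' → θ b b' →
    θ (FLewAlgebra.res a b) (FLewAlgebra.res a' b')
  inf : ∀ {a a' b b' : A}, θ a a' → θ b b' → θ (a ⊓ b) (a' ⊓ b')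
  sup : ∀ {a a' b b' : A}, θ a a' → θ b b' → θ (a ⊔ b) (a' ⊔ b')

/-- `A` is subdirectly irreducible: it is trivial, or there is a least congruence among those
different from equality. -/
def IsSubdirectlyIrreducible (A : Type u) [MTLAlgebra A] : Prop :=
  Subsingleton A ∨
    ∃ μ : Setoid A, IsCongruence μ ∧ μ ≠ ⊥ ∧
      ∀ θ : Setoid A, IsCongruence θ → θ ≠ ⊥ → μ ≤ θ

/-- Membership in the subalgebra of `A` generated by `S`. -/
inductive MemGenerated {A : Type u} [MTLAlgebra A] (S : Set A) : A → Prop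
  | base {a : A} : a ∈ S → MemGenerated S a
  | zero : MemGenerated S ⊥
  | one : MemGenerated S 1
  | mul {a b : A} : MemGenerated S a → MemGenerated S b → MemGenerated S (a * b)
  | res {a b : A} : MemGenerated S a → MemGenerated S b →
      MemGenerated S (FLewAlgebra.res a b)
  | inf {a b : A} : MemGenerated S a → MemGenerated S b → MemGenerated S (a ⊓ b)
  | sup {a b : A} : MemGenerated S a → MemGenerated S b → MemGenerated S (a ⊔ b)

namespace AxiomaticExtension

/-- `A` is an L-algebra, that is, it belongs to the variety corresponding to `L`. -/
def IsAlgebra (L : AxiomaticExtension) (A : Type u) [MTLAlgebra A] : Prop :=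
  ∀ φ ∈ L.extraAxioms, Valid A φ

/-- `L` is complete with respect to the algebra `A`. -/
def IsCompleteWrt (L : AxiomaticExtension) (A : Type u) [MTLAlgebra A] : Prop :=
  ∀ φ : Formula, L.Provable φ ↔ Valid A φ

/-- `A` is a generic L-algebra: it is an L-algebra that generates the variety of L-algebras, i.e.
every identity that holds in `A` holds in all L-algebras. -/
def IsGeneric (L : AxiomaticExtension) (A : Type u) [MTLAlgebra A] : Prop :=
  L.IsAlgebra A ∧ ∀ s t : Formula, SatisfiesIdentity A s t →
    ∀ (B : Type u) [MTLAlgebra B], L.IsAlgebra B → SatisfiesIdentity B s t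

/-- Single chain completeness. -/
def SCC (L : AxiomaticExtension) : Prop :=
  ∃ (A : Type u) (_ : MTLAlgebra A), L.IsAlgebra A ∧ IsMTLChain A ∧ L.IsCompleteWrt A

/-- Subdirect single chain completeness. -/
def SubSCC (L : AxiomaticExtension) : Prop :=
  ∃ (A : Type u) (_ : MTLAlgebra A), IsSubdirectlyIrreducible A ∧ L.IsGeneric A

/-- The variety of L-algebras is locally finite: finitely generated subalgebras of L-algebras
are finite. -/
def LocallyFiniteVariety (L : AxiomaticExtension) : Prop :=
  ∀ (A : Type u) [MTLAlgebra A], L.IsAlgebra A →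
    ∀ S : Set A, S.Finite → {a : A | MemGenerated S a}.Finite

/-- `L` is `n`-contractive: `⊢_L φⁿ → φⁿ⁺¹` for all `φ`. -/
def IsContractive (L : AxiomaticExtension) (n : ℕ) : Prop :=
  ∀ φ : Formula, L.Provable (Formula.imp (φ.pow n) (φ.pow (n + 1)))

end AxiomaticExtension

end MTL

/-! Contractivity is read off the Lindenbaum algebra of `L`: the class of one variable generates a
finite subalgebra, so two of its powers coincide; powers descend, so two consecutive ones coincide,
and substitution carries this to every formula.

For subSCC to SCC, a subdirectly irreducible algebra is a chain
(`IsSubdirectlyIrreducible.isMTLChain`), since by prelinearity two incomparable elements yield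
nontrivial filters meeting only in 1. Genericity becomes completeness because the Lindenbaum algebra
is an `L`-algebra in which only theorems are valid.

For SCC to subSCC, a nontrivial complete chain `A` is embedded by constants into a quotient of a
power of `A` (`IsMTLChain.exists_isSubdirectlyIrreducible`). The filter is chosen so that the class
of one function lies in every nontrivial filter of the quotient, yet no constant other than 1 is
collapsed to 1. The quotient inherits the validities of `A` and, containing a copy of `A`, satisfies
no further identities. -/

namespace MTL

open FLewAlgebra

/-! ### Arithmetic of residuation and prelinearity -/

section Residuation

variable {A : Type u} [MTLAlgebra A]

theorem le_one_of_mtl (x : A) : x ≤ 1 := by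
  rw [one_eq_top]; exact le_top

theorem res_eq_one_iff {x y : A} : res x y = 1 ↔ x ≤ y := by
  rw [← one_mul x, mul_le_iff_le_res, one_mul]
  exact ⟨fun h => h.ge, fun h => le_antisymm (le_one_of_mtl _) h⟩

theorem mul_mono_left {x y : A} (h : x ≤ y) (z : A) : x * z ≤ y * z :=
  (mul_le_iff_le_res _ _ _).2 (h.trans ((mul_le_iff_le_res _ _ _).1 le_rfl))

theorem mul_mono {x y z w : A} (h : x ≤ y) (h' : z ≤ w) : x * z ≤ y * w := by
  refine (mul_mono_left h z).trans ?_
  rw [mul_comm y, mul_comm y]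
  exact mul_mono_left h' y

theorem mul_le_left (x y : A) : x * y ≤ x := by
  simpa using mul_mono (le_refl x) (le_one_of_mtl y)

theorem mul_le_right (x y : A) : x * y ≤ y := by
  simpa using mul_mono (le_one_of_mtl x) (le_refl y)

theorem res_mul_le (x y : A) : res x y * x ≤ y :=
  (mul_le_iff_le_res _ _ _).2 le_rfl

theorem mul_res_le (x y : A) : x * res x y ≤ y := by
  rw [mul_comm]; exact res_mul_le x y

theorem res_trans (x y z : A) : res x y * res y z ≤ res x z := by
  rw [← mul_le_iff_le_res]
  calc res x y * res y z * x = res y z * (res x y * x) := by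
        rw [mul_comm (res x y), mul_assoc]
    _ ≤ res y z * y := mul_mono le_rfl (res_mul_le x y)
    _ ≤ z := res_mul_le y z

theorem res_mul (x y z : A) : res (x * y) z = res x (res y z) := by
  apply le_antisymm
  · rw [← mul_le_iff_le_res, ← mul_le_iff_le_res, mul_assoc]
    exact res_mul_le _ _
  · rw [← mul_le_iff_le_res, ← mul_assoc]
    exact (mul_mono_left (res_mul_le _ _) _).trans (res_mul_le _ _)

theorem sup_mul_le {x y z w : A} (hx : x * z ≤ w) (hy : y * z ≤ w) : (x ⊔ y) * z ≤ w := by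
  rw [mul_le_iff_le_res] at *
  exact sup_le hx hy

/-- If `w` is reached from both `x ⇒ y` and `y ⇒ x`, it is reached outright. -/
theorem le_of_res_mul_le {x y z w : A} (h : res x y * z ≤ w) (h' : res y x * z ≤ w) : z ≤ w := by
  simpa [MTLAlgebra.prelinearity] using sup_mul_le h h'

theorem sup_mul_eq_one {x y z : A} (hy : x ⊔ y = 1) (hz : x ⊔ z = 1) : x ⊔ y * z = 1 := by
  refine le_antisymm (le_one_of_mtl _) ?_
  calc (1 : A) = (x ⊔ y) * (x ⊔ z) := by rw [hy, hz, one_mul]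
    _ ≤ x ⊔ y * z := by
      refine sup_mul_le ((mul_le_left _ _).trans le_sup_left) ?_
      rw [mul_comm]
      refine sup_mul_le ((mul_le_left _ _).trans le_sup_left) ?_
      rw [mul_comm]
      exact le_sup_right

theorem sup_pow_eq_one {x y : A} (h : x ⊔ y = 1) (n : ℕ) : x ⊔ y ^ n = 1 := by
  induction n with
  | zero => rw [pow_zero]; exact le_antisymm (le_one_of_mtl _) le_sup_right
  | succ n ih => rw [pow_succ]; exact sup_mul_eq_one ih h

end Residuation

/-! ### Soundness and substitution -/

section Semantics

theorem Formula.eval_subst {A : Type u} [MTLAlgebra A] (v : ℕ → A) (σ : ℕ → Formula)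
    (φ : Formula) : (φ.subst σ).eval v = φ.eval (fun i => (σ i).eval v) := by
  induction φ <;> simp_all [Formula.subst, Formula.eval]

theorem Formula.eval_pow {A : Type u} [MTLAlgebra A] (v : ℕ → A) (φ : Formula) (n : ℕ) :
    (φ.pow n).eval v = φ.eval v ^ n := by
  match n with
  | 0 => simpa [Formula.pow, Formula.eval] using res_eq_one_iff.2 le_rfl
  | 1 => simp [Formula.pow]
  | n + 2 => rw [Formula.pow, Formula.eval, Formula.eval_pow v φ (n + 1), pow_succ _ (n + 1)]

theorem Formula.subst_pow (σ : ℕ → Formula) (φ : Formula) (n : ℕ) :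
    (φ.pow n).subst σ = (φ.subst σ).pow n := by
  match n with
  | 0 => rfl
  | 1 => rfl
  | n + 2 => rw [Formula.pow, Formula.subst, Formula.subst_pow σ φ (n + 1), Formula.pow]

theorem Formula.subst_subst (σ τ : ℕ → Formula) (φ : Formula) :
    (φ.subst σ).subst τ = φ.subst (fun i => (σ i).subst τ) := by
  induction φ <;> simp_all [Formula.subst]

theorem MTLAxiom.valid {A : Type u} [MTLAlgebra A] {φ : Formula} (h : MTLAxiom φ) :
    Valid A φ := by
  intro v
  cases h with
  | a1 φ ψ χ =>
    simp only [Formula.eval, res_eq_one_iff]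
    rw [← mul_le_iff_le_res]; exact res_trans _ _ _
  | a2 φ ψ => simp only [Formula.eval, res_eq_one_iff]; exact mul_le_left _ _
  | a3 φ ψ => simp only [Formula.eval, res_eq_one_iff]; exact (mul_comm _ _).le
  | a4 φ ψ => simp only [Formula.eval, res_eq_one_iff]; exact inf_le_left
  | a5 φ ψ => simp only [Formula.eval, res_eq_one_iff]; exact (inf_comm _ _).le
  | a6 φ ψ =>
    simp only [Formula.eval, res_eq_one_iff]
    exact le_inf (mul_res_le _ _) (mul_le_left _ _)
  | a7a φ ψ χ => simp only [Formula.eval, res_eq_one_iff]; exact (res_mul _ _ _).ge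
  | a7b φ ψ χ => simp only [Formula.eval, res_eq_one_iff]; exact (res_mul _ _ _).le
  | a8 φ ψ χ =>
    simp only [Formula.eval, res_eq_one_iff]
    rw [← mul_le_iff_le_res]
    refine le_of_res_mul_le (x := φ.eval v) (y := ψ.eval v) ?_ ?_
    · exact (mul_mono le_rfl (mul_le_left _ _)).trans (mul_res_le _ _)
    · exact (mul_mono le_rfl (mul_le_right _ _)).trans (mul_res_le _ _)
  | a9 φ => simp only [Formula.eval, res_eq_one_iff]; exact bot_le

theorem AxiomaticExtension.Provable.valid {L : AxiomaticExtension} {A : Type u} [MTLAlgebra A]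
    (hA : L.IsAlgebra A) {φ : Formula} (h : L.Provable φ) : Valid A φ := by
  induction h with
  | mtl h => exact h.valid
  | extra σ h => intro v; rw [Formula.eval_subst]; exact hA _ h _
  | mp _ _ ih ih' =>
    intro v
    have h := ih' v
    rw [Formula.eval, res_eq_one_iff, ih v] at h
    exact le_antisymm (le_one_of_mtl _) h

theorem MTLAxiom.subst {φ : Formula} (h : MTLAxiom φ) (σ : ℕ → Formula) :
    MTLAxiom (φ.subst σ) := by
  cases h <;> simp only [Formula.subst] <;> constructor

theorem AxiomaticExtension.Provable.subst {L : AxiomaticExtension} {φ : Formula}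
    (h : L.Provable φ) (σ : ℕ → Formula) : L.Provable (φ.subst σ) := by
  induction h with
  | mtl h => exact .mtl (h.subst σ)
  | extra τ h => rw [Formula.subst_subst]; exact .extra _ h
  | mp _ _ ih ih' => exact .mp ih ih'

/-- An identity of an algebra with respect to which `L` is complete holds in all `L`-algebras. -/
theorem AxiomaticExtension.IsCompleteWrt.satisfiesIdentity {L : AxiomaticExtension}
    {A : Type u} [MTLAlgebra A] (hA : L.IsCompleteWrt A) {s t : Formula}
    (h : SatisfiesIdentity A s t) {B : Type u} [MTLAlgebra B] (hB : L.IsAlgebra B) :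
    SatisfiesIdentity B s t := by
  have h₁ : L.Provable (.imp s t) := (hA _).2 fun v => res_eq_one_iff.2 (h v).le
  have h₂ : L.Provable (.imp t s) := (hA _).2 fun v => res_eq_one_iff.2 (h v).ge
  exact fun v => le_antisymm (res_eq_one_iff.1 (h₁.valid hB v)) (res_eq_one_iff.1 (h₂.valid hB v))

end Semantics

/-! ### Quotients of preorders, shared by the Lindenbaum algebra and the filter quotients -/

/-- A preordered prelinear residuated structure; its quotient by the equivalence of the preorder
is an MTL-algebra. -/
structure MTLPreorder (X : Type u) where
  le : X → X → Prop
  mul : X → X → X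
  res : X → X → X
  inf : X → X → X
  sup : X → X → X
  bot : X
  one : X
  le_refl : ∀ x, le x x
  le_trans : ∀ {x y z}, le x y → le y z → le x z
  mul_comm : ∀ x y, le (mul x y) (mul y x)
  mul_assoc : ∀ x y z, le (mul (mul x y) z) (mul x (mul y z))
  mul_assoc' : ∀ x y z, le (mul x (mul y z)) (mul (mul x y) z)
  le_one_mul : ∀ x, le x (mul one x)
  one_mul_le : ∀ x, le (mul one x) x
  mul_le_iff : ∀ x y z, le (mul z x) y ↔ le z (res x y)
  inf_le_left : ∀ x y, le (inf x y) x
  inf_le_right : ∀ x y, le (inf x y) y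
  le_inf : ∀ {x y z}, le x y → le x z → le x (inf y z)
  le_sup_left : ∀ x y, le x (sup x y)
  le_sup_right : ∀ x y, le y (sup x y)
  sup_le : ∀ {x y z}, le x z → le y z → le (sup x y) z
  bot_le : ∀ x, le bot x
  le_one : ∀ x, le x one
  prelinearity : ∀ x y, le one (sup (res x y) (res y x))

namespace MTLPreorder

variable {X : Type u} (P : MTLPreorder X)

/-- The equivalence associated with the preorder. -/
def setoid : Setoid X where
  r x y := P.le x y ∧ P.le y x
  iseqv := ⟨fun x => ⟨P.le_refl x, P.le_refl x⟩, fun h => ⟨h.2, h.1⟩,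
    fun h h' => ⟨P.le_trans h.1 h'.1, P.le_trans h'.2 h.2⟩⟩

theorem mul_mono {x x' y y' : X} (h : P.le x x') (h' : P.le y y') :
    P.le (P.mul x y) (P.mul x' y') := by
  have key : ∀ {x x' : X} (y : X), P.le x x' → P.le (P.mul x y) (P.mul x' y) := fun y h =>
    (P.mul_le_iff _ _ _).2 (P.le_trans h ((P.mul_le_iff _ _ _).1 (P.le_refl _)))
  exact P.le_trans (key y h)
    (P.le_trans (P.mul_comm _ _) (P.le_trans (key x' h') (P.mul_comm _ _)))

theorem res_mono {x x' y y' : X} (h : P.le x' x) (h' : P.le y y') :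
    P.le (P.res x y) (P.res x' y') :=
  (P.mul_le_iff _ _ _).1 (P.le_trans (P.mul_mono (P.le_refl _) h)
    (P.le_trans ((P.mul_le_iff _ _ _).2 (P.le_refl _)) h'))

theorem inf_mono {x x' y y' : X} (h : P.le x x') (h' : P.le y y') :
    P.le (P.inf x y) (P.inf x' y') :=
  P.le_inf (P.le_trans (P.inf_le_left _ _) h) (P.le_trans (P.inf_le_right _ _) h')

theorem sup_mono {x x' y y' : X} (h : P.le x x') (h' : P.le y y') :
    P.le (P.sup x y) (P.sup x' y') :=
  P.sup_le (P.le_trans h (P.le_sup_left _ _)) (P.le_trans h' (P.le_sup_right _ _))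

/-- The quotient by the equivalence associated with the preorder. -/
def Quot : Type u := Quotient P.setoid

/-- The quotient map. -/
def cls (x : X) : P.Quot := Quotient.mk P.setoid x

theorem cls_surjective : Function.Surjective P.cls := Quotient.exists_rep

theorem cls_sound {x y : X} (h : P.le x y) (h' : P.le y x) : P.cls x = P.cls y :=
  Quotient.sound (s := P.setoid) ⟨h, h'⟩

instance : MTLAlgebra P.Quot where
  le := Quotient.lift₂ (s₁ := P.setoid) (s₂ := P.setoid) P.le fun _ _ _ _ h h' => propext
    ⟨fun k => P.le_trans h.2 (P.le_trans k h'.1), fun k => P.le_trans h.1 (P.le_trans k h'.2)⟩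
  le_refl := by rintro ⟨x⟩; exact P.le_refl x
  le_trans := by rintro ⟨x⟩ ⟨y⟩ ⟨z⟩ h h'; exact P.le_trans h h'
  le_antisymm := by rintro ⟨x⟩ ⟨y⟩ h h'; exact P.cls_sound h h'
  inf := Quotient.map₂ P.inf fun _ _ h _ _ h' => ⟨P.inf_mono h.1 h'.1, P.inf_mono h.2 h'.2⟩
  sup := Quotient.map₂ P.sup fun _ _ h _ _ h' => ⟨P.sup_mono h.1 h'.1, P.sup_mono h.2 h'.2⟩
  inf_le_left := by rintro ⟨x⟩ ⟨y⟩; exact P.inf_le_left x y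
  inf_le_right := by rintro ⟨x⟩ ⟨y⟩; exact P.inf_le_right x y
  le_inf := by rintro ⟨x⟩ ⟨y⟩ ⟨z⟩ h h'; exact P.le_inf h h'
  le_sup_left := by rintro ⟨x⟩ ⟨y⟩; exact P.le_sup_left x y
  le_sup_right := by rintro ⟨x⟩ ⟨y⟩; exact P.le_sup_right x y
  sup_le := by rintro ⟨x⟩ ⟨y⟩ ⟨z⟩ h h'; exact P.sup_le h h'
  top := P.cls P.one
  le_top := by rintro ⟨x⟩; exact P.le_one x
  bot := P.cls P.bot
  bot_le := by rintro ⟨x⟩; exact P.bot_le x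
  one := P.cls P.one
  mul := Quotient.map₂ P.mul fun _ _ h _ _ h' => ⟨P.mul_mono h.1 h'.1, P.mul_mono h.2 h'.2⟩
  mul_assoc := by rintro ⟨x⟩ ⟨y⟩ ⟨z⟩; exact P.cls_sound (P.mul_assoc x y z) (P.mul_assoc' x y z)
  mul_comm := by rintro ⟨x⟩ ⟨y⟩; exact P.cls_sound (P.mul_comm x y) (P.mul_comm y x)
  one_mul := by rintro ⟨x⟩; exact P.cls_sound (P.one_mul_le x) (P.le_one_mul x)
  mul_one := by
    rintro ⟨x⟩
    exact P.cls_sound (P.le_trans (P.mul_comm _ _) (P.one_mul_le x))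
      (P.le_trans (P.le_one_mul x) (P.mul_comm _ _))
  res := Quotient.map₂ P.res fun _ _ h _ _ h' => ⟨P.res_mono h.2 h'.1, P.res_mono h.1 h'.2⟩
  one_eq_top := rfl
  mul_le_iff_le_res := by rintro ⟨x⟩ ⟨y⟩ ⟨z⟩; exact P.mul_le_iff x y z
  prelinearity := by rintro ⟨x⟩ ⟨y⟩; exact P.cls_sound (P.le_one _) (P.prelinearity x y)

theorem cls_le_cls {x y : X} : P.cls x ≤ P.cls y ↔ P.le x y := Iff.rfl

theorem cls_eq_one_iff {x : X} : P.cls x = 1 ↔ P.le P.one x :=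
  ⟨fun h => P.cls_le_cls.1 h.ge, fun h => P.cls_sound (P.le_one x) h⟩

end MTLPreorder

/-! ### Derivations in MTL, the Lindenbaum algebra and contractivity -/

section Lindenbaum

open Formula AxiomaticExtension

variable {L : AxiomaticExtension} {φ ψ χ : Formula}

theorem prov_trans (h : L.Provable (imp φ ψ)) (h' : L.Provable (imp ψ χ)) :
    L.Provable (imp φ χ) :=
  .mp h' (.mp h (.mtl (.a1 _ _ _)))

theorem prov_conj_imp_iff : L.Provable (imp (conj φ ψ) χ) ↔ L.Provable (imp φ (imp ψ χ)) :=
  ⟨fun h => .mp h (.mtl (.a7b _ _ _)), fun h => .mp h (.mtl (.a7a _ _ _))⟩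

theorem prov_weaken (φ ψ : Formula) : L.Provable (imp φ (imp ψ φ)) :=
  prov_conj_imp_iff.1 (.mtl (.a2 _ _))

theorem prov_swap (h : L.Provable (imp φ (imp ψ χ))) : L.Provable (imp ψ (imp φ χ)) :=
  prov_conj_imp_iff.1 (prov_trans (.mtl (.a3 _ _)) (prov_conj_imp_iff.2 h))

theorem prov_refl (φ : Formula) : L.Provable (imp φ φ) :=
  .mp (.mtl (.a9 bot)) (prov_swap (prov_weaken φ (imp bot bot)))

theorem prov_modus_ponens (φ ψ : Formula) : L.Provable (imp φ (imp (imp φ ψ) ψ)) :=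
  prov_swap (prov_refl _)

theorem prov_meet_left (φ ψ : Formula) : L.Provable (imp (meet φ ψ) φ) := .mtl (.a4 _ _)

theorem prov_meet_right (φ ψ : Formula) : L.Provable (imp (meet φ ψ) ψ) :=
  prov_trans (.mtl (.a5 _ _)) (.mtl (.a4 _ _))

theorem prov_prelinear (h : L.Provable (imp (imp φ ψ) χ)) (h' : L.Provable (imp (imp ψ φ) χ)) :
    L.Provable χ :=
  .mp h' (.mp h (.mtl (.a8 _ _ _)))

theorem prov_imp_trans_left (h : L.Provable (imp φ ψ)) (χ : Formula) :
    L.Provable (imp (imp ψ χ) (imp φ χ)) :=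
  .mp h (.mtl (.a1 _ _ _))

/-- Prelinearity splits into two cases: under `φ → ψ`, divisibility axiom `a6` makes `φ` imply the
meet; under `ψ → φ`, `ψ` does. -/
theorem prov_meet_intro (h : L.Provable (imp χ φ)) (h' : L.Provable (imp χ ψ)) :
    L.Provable (imp χ (meet φ ψ)) := by
  refine prov_prelinear (φ := φ) (ψ := ψ) ?_ ?_
  · refine prov_trans (ψ := imp φ (meet φ ψ)) (prov_swap (prov_conj_imp_iff.1 ?_))
      (prov_imp_trans_left h _)
    exact prov_trans (.mtl (.a6 _ _)) (.mtl (.a5 _ _))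
  · refine prov_trans (ψ := imp ψ (meet φ ψ)) (prov_swap (prov_conj_imp_iff.1 ?_))
      (prov_imp_trans_left h' _)
    exact .mtl (.a6 _ _)

/-- The defined disjunction. -/
def Formula.join (φ ψ : Formula) : Formula :=
  meet (imp (imp φ ψ) ψ) (imp (imp ψ φ) φ)

theorem prov_join_left (φ ψ : Formula) : L.Provable (imp φ (join φ ψ)) :=
  prov_meet_intro (prov_modus_ponens _ _) (prov_weaken _ _)

theorem prov_join_right (φ ψ : Formula) : L.Provable (imp ψ (join φ ψ)) :=
  prov_meet_intro (prov_weaken _ _) (prov_modus_ponens _ _)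

theorem prov_imp_trans_right (h : L.Provable (imp φ ψ)) (χ : Formula) :
    L.Provable (imp (imp χ φ) (imp χ ψ)) :=
  .mp h (prov_swap (.mtl (.a1 _ _ _)))

/-- Under `φ → ψ` the first component of the join gives `ψ`, hence `χ`; the other case is symmetric.
-/
theorem prov_join_elim (h : L.Provable (imp φ χ)) (h' : L.Provable (imp ψ χ)) :
    L.Provable (imp (join φ ψ) χ) :=
  prov_prelinear (φ := φ) (ψ := ψ)
    (prov_swap (prov_trans (prov_meet_left _ _) (prov_imp_trans_right h' _)))
    (prov_swap (prov_trans (prov_meet_right _ _) (prov_imp_trans_right h _)))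

variable (L) in
/-- Formulas preordered by provable implication. -/
def AxiomaticExtension.formulaPreorder : MTLPreorder (ULift.{u} Formula) where
  -- The lift places the quotient in the universe over which `L`-algebras are quantified.
  le φ ψ := L.Provable (imp φ.down ψ.down)
  mul φ ψ := ⟨conj φ.down ψ.down⟩
  res φ ψ := ⟨imp φ.down ψ.down⟩
  inf φ ψ := ⟨meet φ.down ψ.down⟩
  sup φ ψ := ⟨join φ.down ψ.down⟩
  bot := ⟨.bot⟩
  one := ⟨imp .bot .bot⟩
  le_refl _ := prov_refl _
  le_trans := prov_trans
  mul_comm _ _ := .mtl (.a3 _ _)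
  mul_assoc _ _ _ := prov_conj_imp_iff.2 (prov_conj_imp_iff.2
    (prov_trans (prov_conj_imp_iff.1 (prov_refl _)) (.mtl (.a7b _ _ _))))
  mul_assoc' _ _ _ := prov_conj_imp_iff.2
    (prov_trans (prov_conj_imp_iff.1 (prov_conj_imp_iff.1 (prov_refl _))) (.mtl (.a7a _ _ _)))
  le_one_mul _ := .mp (prov_refl _) (prov_conj_imp_iff.1 (prov_refl _))
  one_mul_le _ := prov_trans (.mtl (.a3 _ _)) (.mtl (.a2 _ _))
  mul_le_iff _ _ _ := prov_conj_imp_iff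
  inf_le_left _ _ := prov_meet_left _ _
  inf_le_right _ _ := prov_meet_right _ _
  le_inf := prov_meet_intro
  le_sup_left _ _ := prov_join_left _ _
  le_sup_right _ _ := prov_join_right _ _
  sup_le := prov_join_elim
  bot_le _ := .mtl (.a9 _)
  le_one _ := .mp (prov_refl _) (prov_weaken _ _)
  prelinearity _ _ := .mp (prov_prelinear (prov_join_left _ _) (prov_join_right _ _))
    (prov_weaken _ _)

variable (L) in
/-- The Lindenbaum algebra of `L`. -/
abbrev AxiomaticExtension.Lindenbaum : Type u := L.formulaPreorder.{u}.Quot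

variable (L) in
/-- The class of a formula in the Lindenbaum algebra. -/
def AxiomaticExtension.toLindenbaum (φ : Formula) : Lindenbaum.{u} L :=
  L.formulaPreorder.cls ⟨φ⟩

theorem eval_toLindenbaum (σ : ℕ → Formula) (φ : Formula) :
    φ.eval (fun i => toLindenbaum.{u} L (σ i)) = L.toLindenbaum (φ.subst σ) := by
  induction φ with
  | var i => rfl
  | bot => rfl
  | conj φ ψ ih ih' => rw [Formula.eval, ih, ih']; rfl
  | meet φ ψ ih ih' => rw [Formula.eval, ih, ih']; rfl
  | imp φ ψ ih ih' => rw [Formula.eval, ih, ih']; rfl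

theorem toLindenbaum_eq_one_iff : toLindenbaum.{u} L φ = 1 ↔ L.Provable φ := by
  rw [toLindenbaum, MTLPreorder.cls_eq_one_iff]
  exact ⟨fun h => .mp (prov_refl _) h, fun h => .mp h (prov_weaken _ _)⟩

-- An assignment in the Lindenbaum algebra is induced by a substitution, and substitution instances
-- of the extra axioms are provable.
variable (L) in
theorem AxiomaticExtension.isAlgebra_lindenbaum : L.IsAlgebra (Lindenbaum.{u} L) := by
  intro φ hφ v
  choose w hw using fun i => L.formulaPreorder.cls_surjective (v i)
  have hv : v = fun i => L.toLindenbaum (w i).down := funext fun i => (hw i).symm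
  rw [hv, eval_toLindenbaum, toLindenbaum_eq_one_iff]
  exact .extra _ hφ

theorem subst_var (φ : Formula) : φ.subst var = φ := by
  induction φ <;> simp_all [Formula.subst]

theorem provable_of_valid_lindenbaum (h : Valid (Lindenbaum.{u} L) φ) : L.Provable φ := by
  rw [← toLindenbaum_eq_one_iff.{u}, ← subst_var φ, ← eval_toLindenbaum]
  exact h _

theorem memGenerated_pow {A : Type u} [MTLAlgebra A] (x : A) (n : ℕ) :
    MemGenerated {x} (x ^ n) := by
  induction n with
  | zero => rw [pow_zero]; exact .one
  | succ n ih => rw [pow_succ]; exact .mul ih (.base rfl)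

theorem exists_pow_le_pow_succ {A : Type u} [MTLAlgebra A] {x : A}
    (h : {a : A | MemGenerated {x} a}.Finite) : ∃ n : ℕ, 0 < n ∧ x ^ n ≤ x ^ (n + 1) := by
  -- The exponents are shifted by one so that the resulting `n` is positive.
  obtain ⟨m, k, hmk, he⟩ : ∃ m k : ℕ, m < k ∧ x ^ (m + 1) = x ^ (k + 1) := by
    by_contra! hne
    refine Set.infinite_of_injective_forall_mem (f := fun n : ℕ => x ^ (n + 1)) ?_
      (fun n => memGenerated_pow x (n + 1)) h
    exact Function.Injective.of_lt_imp_ne fun m k hmk => hne m k hmk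
  refine ⟨m + 1, m.succ_pos, ?_⟩
  obtain ⟨d, rfl⟩ := Nat.exists_eq_add_of_lt hmk
  calc x ^ (m + 1) = x ^ (m + 1 + 1) * x ^ d := by rw [he, ← pow_add]; congr 1; ring
    _ ≤ x ^ (m + 1 + 1) := mul_le_left _ _

theorem exists_isContractive (hL : LocallyFiniteVariety.{u} L) :
    ∃ n : ℕ, 0 < n ∧ L.IsContractive n := by
  obtain ⟨n, hn, h⟩ := exists_pow_le_pow_succ
    (hL (Lindenbaum L) L.isAlgebra_lindenbaum {L.toLindenbaum (var 0)} (Set.finite_singleton _))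
  refine ⟨n, hn, fun φ => ?_⟩
  have key : L.Provable (imp ((var 0).pow n) ((var 0).pow (n + 1))) := by
    rw [← toLindenbaum_eq_one_iff.{u}, ← subst_var (imp _ _), ← eval_toLindenbaum,
      Formula.eval, res_eq_one_iff, Formula.eval_pow, Formula.eval_pow]
    exact h
  have := key.subst fun _ => φ
  rwa [Formula.subst, Formula.subst_pow, Formula.subst_pow] at this

end Lindenbaum

/-! ### Filters, congruences and subdirect irreducibility -/

section Filters

/-- Filters of an MTL-algebra (up-sets closed under multiplication). -/
structure IsMTLFilter {A : Type u} [MTLAlgebra A] (F : Set A) : Prop where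
  one_mem : 1 ∈ F
  mul_mem : ∀ {x y : A}, x ∈ F → y ∈ F → x * y ∈ F
  mem_of_le : ∀ {x y : A}, x ∈ F → x ≤ y → y ∈ F

namespace IsMTLFilter

variable {A : Type u} [MTLAlgebra A] {F : Set A} (hF : IsMTLFilter F)

theorem res_mem_of_le {F : Set A} (hF : IsMTLFilter F) {x y : A} (h : x ≤ y) : res x y ∈ F := by
  rw [res_eq_one_iff.2 h]; exact hF.one_mem

/-- The preorder `x ⇒ y ∈ F` associated with a filter `F`. -/
def preorder : MTLPreorder A where
  le x y := res x y ∈ F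
  mul := (· * ·)
  res := res
  inf := (· ⊓ ·)
  sup := (· ⊔ ·)
  bot := ⊥
  one := 1
  le_refl _ := hF.res_mem_of_le le_rfl
  le_trans h h' := hF.mem_of_le (hF.mul_mem h h') (res_trans _ _ _)
  mul_comm _ _ := hF.res_mem_of_le (_root_.mul_comm _ _).le
  mul_assoc _ _ _ := hF.res_mem_of_le (_root_.mul_assoc _ _ _).le
  mul_assoc' _ _ _ := hF.res_mem_of_le (_root_.mul_assoc _ _ _).ge
  le_one_mul _ := hF.res_mem_of_le (one_mul _).ge
  one_mul_le _ := hF.res_mem_of_le (one_mul _).le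
  mul_le_iff _ _ _ := by rw [res_mul]
  inf_le_left _ _ := hF.res_mem_of_le _root_.inf_le_left
  inf_le_right _ _ := hF.res_mem_of_le _root_.inf_le_right
  le_inf {x y z} h h' := hF.mem_of_le (hF.mul_mem h h') <| by
    rw [← mul_le_iff_le_res]
    exact _root_.le_inf ((mul_mono_left (mul_le_left _ _) _).trans (res_mul_le _ _))
      ((mul_mono_left (mul_le_right _ _) _).trans (res_mul_le _ _))
  le_sup_left _ _ := hF.res_mem_of_le _root_.le_sup_left
  le_sup_right _ _ := hF.res_mem_of_le _root_.le_sup_right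
  sup_le {x y z} h h' := hF.mem_of_le (hF.mul_mem h h') <| by
    rw [← mul_le_iff_le_res, _root_.mul_comm]
    exact sup_mul_le ((mul_mono le_rfl (mul_le_left _ _)).trans (mul_res_le _ _))
      ((mul_mono le_rfl (mul_le_right _ _)).trans (mul_res_le _ _))
  bot_le _ := hF.res_mem_of_le _root_.bot_le
  le_one _ := hF.res_mem_of_le (le_one_of_mtl _)
  prelinearity _ _ := hF.res_mem_of_le (MTLAlgebra.prelinearity _ _).ge

theorem one_res (x : A) : res 1 x = x := by
  apply le_antisymm
  · simpa using res_mul_le 1 x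
  · rw [← mul_le_iff_le_res, mul_one]

theorem cls_eq_one_iff {x : A} : hF.preorder.cls x = 1 ↔ x ∈ F := by
  rw [MTLPreorder.cls_eq_one_iff]
  change res 1 x ∈ F ↔ _
  rw [one_res]

theorem cls_le_cls {x y : A} : hF.preorder.cls x ≤ hF.preorder.cls y ↔ res x y ∈ F := Iff.rfl

theorem eval_cls (v : ℕ → A) (φ : Formula) :
    φ.eval (fun i => hF.preorder.cls (v i)) = hF.preorder.cls (φ.eval v) := by
  induction φ with
  | var i => rfl
  | bot => rfl
  | conj φ ψ ih ih' => rw [Formula.eval, ih, ih']; rfl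
  | meet φ ψ ih ih' => rw [Formula.eval, ih, ih']; rfl
  | imp φ ψ ih ih' => rw [Formula.eval, ih, ih']; rfl

theorem valid_quot {φ : Formula} (h : Valid A φ) : Valid hF.preorder.Quot φ := by
  intro v
  choose w hw using fun i => hF.preorder.cls_surjective (v i)
  obtain rfl : (fun i => hF.preorder.cls (w i)) = v := funext hw
  rw [eval_cls, h w]
  rfl

/-- The congruence of a filter. -/
def congruence : Setoid A := hF.preorder.setoid

theorem congruence_iff {x y : A} : hF.congruence x y ↔ res x y ∈ F ∧ res y x ∈ F := Iff.rfl

theorem isCongruence : IsCongruence hF.congruence where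
  mul h h' := ⟨hF.preorder.mul_mono h.1 h'.1, hF.preorder.mul_mono h.2 h'.2⟩
  res h h' := ⟨hF.preorder.res_mono h.2 h'.1, hF.preorder.res_mono h.1 h'.2⟩
  inf h h' := ⟨hF.preorder.inf_mono h.1 h'.1, hF.preorder.inf_mono h.2 h'.2⟩
  sup h h' := ⟨hF.preorder.sup_mono h.1 h'.1, hF.preorder.sup_mono h.2 h'.2⟩

theorem congruence_ne_bot {x : A} (hx : x ∈ F) (h1 : x ≠ 1) : hF.congruence ≠ ⊥ := by
  intro h
  have : hF.congruence x 1 :=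
    hF.congruence_iff.2 ⟨hF.res_mem_of_le (le_one_of_mtl x), by rwa [one_res]⟩
  rw [h] at this
  exact h1 this

end IsMTLFilter

variable {A : Type u} [MTLAlgebra A]

/-- The filter generated by an element. -/
def principalFilter (c : A) : Set A := {z | ∃ n : ℕ, c ^ n ≤ z}

theorem isMTLFilter_principalFilter (c : A) : IsMTLFilter (principalFilter c) where
  one_mem := ⟨0, (pow_zero c).le⟩
  mul_mem := by
    rintro x y ⟨n, hn⟩ ⟨m, hm⟩
    exact ⟨n + m, by rw [pow_add]; exact mul_mono hn hm⟩
  mem_of_le := by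
    rintro x y ⟨n, hn⟩ h
    exact ⟨n, hn.trans h⟩

theorem mem_principalFilter_self (c : A) : c ∈ principalFilter c := ⟨1, (pow_one c).le⟩

theorem IsMTLFilter.principalFilter_subset {F : Set A} (hF : IsMTLFilter F) {c : A} (hc : c ∈ F) :
    principalFilter c ⊆ F := by
  rintro z ⟨n, hn⟩
  refine hF.mem_of_le ?_ hn
  clear hn
  induction n with
  | zero => rw [pow_zero]; exact hF.one_mem
  | succ n ih => rw [pow_succ]; exact hF.mul_mem ih hc

theorem IsCongruence.isMTLFilter {θ : Setoid A} (hθ : IsCongruence θ) :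
    IsMTLFilter {z | θ z 1} where
  one_mem := θ.refl 1
  mul_mem {x y} hx hy := by
    have := hθ.mul hx hy
    rwa [one_mul] at this
  mem_of_le {x y} hx h := by
    have := hθ.sup hx (θ.refl y)
    rwa [sup_eq_right.2 h, sup_eq_left.2 (le_one_of_mtl y)] at this

/-- The element `x * (x ⇒ y)` is congruent to `x` and lies below `y`, so meeting with `y` fixes it.
-/
theorem IsCongruence.rel_inf_of_res {θ : Setoid A} (hθ : IsCongruence θ) {x y : A}
    (h : θ (FLewAlgebra.res x y) 1) : θ x (x ⊓ y) := by
  have h₁ : θ (x * FLewAlgebra.res x y) x := by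
    have := hθ.mul (θ.refl x) h
    rwa [mul_one] at this
  have h₂ := hθ.inf h₁ (θ.refl y)
  rw [inf_eq_left.2 (mul_res_le x y)] at h₂
  exact θ.trans (θ.symm h₁) h₂

/-- A congruence is thus determined by its filter, the class of 1, and minimality can be tested on
filters. -/
theorem IsCongruence.rel_iff {θ : Setoid A} (hθ : IsCongruence θ) {x y : A} :
    θ x y ↔ θ (FLewAlgebra.res x y) 1 ∧ θ (FLewAlgebra.res y x) 1 := by
  constructor
  · intro h
    have h₁ := hθ.res h (θ.refl y)
    have h₂ := hθ.res (θ.refl y) h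
    rw [res_eq_one_iff.2 (le_refl y)] at h₁ h₂
    exact ⟨h₁, h₂⟩
  · rintro ⟨h, h'⟩
    refine θ.trans (hθ.rel_inf_of_res h) (θ.symm ?_)
    rw [inf_comm]
    exact hθ.rel_inf_of_res h'

/-- An algebra with an element `c ≠ 1` that belongs to all nontrivial filters is subdirectly
irreducible. -/
theorem isSubdirectlyIrreducible_of_forall_filter {c : A} (hc : c ≠ 1)
    (h : ∀ F : Set A, IsMTLFilter F → (∃ x ∈ F, x ≠ 1) → c ∈ F) :
    IsSubdirectlyIrreducible A := by
  have hP := isMTLFilter_principalFilter c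
  refine Or.inr ⟨hP.congruence, hP.isCongruence,
    hP.congruence_ne_bot (mem_principalFilter_self c) hc, fun θ hθ hne => ?_⟩
  have hcθ : c ∈ {z | θ z 1} := by
    refine h _ hθ.isMTLFilter ?_
    by_contra! hall
    refine hne (le_antisymm (fun x y hxy => ?_) bot_le)
    obtain ⟨h₁, h₂⟩ := hθ.rel_iff.1 hxy
    exact le_antisymm (res_eq_one_iff.1 (hall _ h₁)) (res_eq_one_iff.1 (hall _ h₂))
  intro x y hxy
  have hsub := hθ.isMTLFilter.principalFilter_subset hcθ
  exact hθ.rel_iff.2 ⟨hsub hxy.1, hsub hxy.2⟩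

theorem IsSubdirectlyIrreducible.isMTLChain (hA : IsSubdirectlyIrreducible A) : IsMTLChain A := by
  intro x y
  rcases hA with hA | ⟨μ, -, hne, hmin⟩
  · exact Or.inl (Subsingleton.elim x y).le
  by_contra! hxy
  refine hne (le_antisymm (fun a b hab => ?_) bot_le)
  -- A pair in the least congruence is identified by every nontrivial principal filter.
  have key : ∀ c : A, c ≠ 1 → res a b ∈ principalFilter c ∧ res b a ∈ principalFilter c :=
    fun c hc => hmin _ (isMTLFilter_principalFilter c).isCongruence
      ((isMTLFilter_principalFilter c).congruence_ne_bot (mem_principalFilter_self c) hc) hab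
  -- Powers of `x ⇒ y` and `y ⇒ x` still join to 1, so a common upper bound is 1.
  have hle : ∀ z : A, z ∈ principalFilter (res x y) → z ∈ principalFilter (res y x) → z = 1 := by
    rintro z ⟨n, hn⟩ ⟨m, hm⟩
    have h₁ := sup_pow_eq_one (MTLAlgebra.prelinearity x y) m
    rw [sup_comm] at h₁
    refine le_antisymm (le_one_of_mtl z) ?_
    rw [← sup_pow_eq_one h₁ n]
    exact sup_le hm hn
  have hp := key _ fun h => hxy.1 (res_eq_one_iff.1 h)
  have hq := key _ fun h => hxy.2 (res_eq_one_iff.1 h)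
  exact le_antisymm (res_eq_one_iff.1 (hle _ hp.1 hq.1)) (res_eq_one_iff.1 (hle _ hp.2 hq.2))

/-- A filter avoiding `c` extends to one that is maximal among the filters avoiding `c`. -/
theorem IsMTLFilter.exists_maximal {G : Set A} (hG : IsMTLFilter G) {c : A} (hc : c ∉ G) :
    ∃ F, G ⊆ F ∧ Maximal (fun F : Set A => IsMTLFilter F ∧ c ∉ F) F := by
  refine zorn_subset_nonempty {F : Set A | IsMTLFilter F ∧ c ∉ F} ?_ G ⟨hG, hc⟩
  intro C hC hchain hne
  refine ⟨⋃₀ C, ⟨⟨?_, ?_, ?_⟩, ?_⟩, fun s hs => Set.subset_sUnion_of_mem hs⟩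
  · obtain ⟨s, hs⟩ := hne
    exact ⟨s, hs, (hC hs).1.one_mem⟩
  · rintro x y ⟨s, hs, hx⟩ ⟨t, ht, hy⟩
    rcases hchain.total hs ht with h | h
    · exact ⟨t, ht, (hC ht).1.mul_mem (h hx) hy⟩
    · exact ⟨s, hs, (hC hs).1.mul_mem hx (h hy)⟩
  · rintro x y ⟨s, hs, hx⟩ h
    exact ⟨s, hs, (hC hs).1.mem_of_le hx h⟩
  · rintro ⟨s, hs, hcs⟩
    exact (hC hs).2 hcs

/-- The quotient by a filter that is maximal among those avoiding `c` is subdirectly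
irreducible. -/
theorem IsMTLFilter.isSubdirectlyIrreducible_quot {F : Set A} (hF : IsMTLFilter F) {c : A}
    (hmax : Maximal (fun F : Set A => IsMTLFilter F ∧ c ∉ F) F) :
    IsSubdirectlyIrreducible hF.preorder.Quot := by
  refine isSubdirectlyIrreducible_of_forall_filter (c := hF.preorder.cls c)
    (fun h => hmax.prop.2 (hF.cls_eq_one_iff.1 h)) ?_
  rintro G hG ⟨x, hxG, hx1⟩
  obtain ⟨x, rfl⟩ := hF.preorder.cls_surjective x
  by_contra hcG
  -- The preimage of `G` would be a filter avoiding `c` and extending `F`, hence `F` itself by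
  -- maximality, although it contains `x ∉ F`.
  have hpre : IsMTLFilter {z | hF.preorder.cls z ∈ G} :=
    ⟨hG.one_mem, fun h h' => hG.mul_mem h h', fun h h' =>
      hG.mem_of_le h (hF.cls_le_cls.2 (hF.res_mem_of_le h'))⟩
  have hsub : F ⊆ {z | hF.preorder.cls z ∈ G} := fun z hz => by
    rw [Set.mem_ofPred_eq, hF.cls_eq_one_iff.2 hz]
    exact hG.one_mem
  exact hx1 (hF.cls_eq_one_iff.2 (hmax.le_of_ge ⟨hpre, hcG⟩ hsub hxG))

end Filters

/-! ### Powers of a chain and the embedding -/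

section Power

variable {I A : Type u} [MTLAlgebra A]

instance : MTLAlgebra (I → A) where
  res f g i := res (f i) (g i)
  one_eq_top := funext fun _ => one_eq_top
  mul_le_iff_le_res f g h := forall_congr' fun i => mul_le_iff_le_res (f i) (g i) (h i)
  prelinearity f g := funext fun i => MTLAlgebra.prelinearity (f i) (g i)

theorem eval_pi_apply (v : ℕ → I → A) (φ : Formula) (i : I) :
    φ.eval v i = φ.eval (fun n => v n i) := by
  induction φ with
  | var i => rfl
  | bot => rfl
  | conj φ ψ ih ih' => simp only [Formula.eval, ← ih, ← ih']; rfl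
  | meet φ ψ ih ih' => simp only [Formula.eval, ← ih, ← ih']; rfl
  | imp φ ψ ih ih' => simp only [Formula.eval, ← ih, ← ih']; rfl

theorem valid_pi {φ : Formula} (h : Valid A φ) : Valid (I → A) φ := fun v =>
  funext fun i => (eval_pi_apply v φ i).trans (h _)

/-- A nontrivial chain `A` embeds into a subdirectly irreducible algebra that satisfies all the
identities of `A`: in the power `A ^ (A \ {1})`, the identity map lies eventually above every
constant `a ≠ 1`, and one divides by a filter that is maximal among those which avoid it and
contain the functions eventually equal to `1`. -/
theorem IsMTLChain.exists_isSubdirectlyIrreducible [Nontrivial A] (hA : IsMTLChain A) :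
    ∃ (B : Type u) (_ : MTLAlgebra B), IsSubdirectlyIrreducible B ∧
      (∀ φ, Valid A φ → Valid B φ) ∧ ∀ s t, SatisfiesIdentity B s t → SatisfiesIdentity A s t := by
  let I := {a : A // a ≠ 1}
  have hI : Nonempty I := let ⟨a, ha⟩ := exists_ne (1 : A); ⟨⟨a, ha⟩⟩
  let b : I → A := fun i => i
  have hG : IsMTLFilter {f : I → A | ∃ i : I, ∀ j : I, (i : A) ≤ j → f j = 1} := by
    refine ⟨hI.elim fun i => ⟨i, fun _ _ => rfl⟩, ?_, ?_⟩
    · rintro f g ⟨i, hi⟩ ⟨j, hj⟩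
      rcases hA i j with h | h
      · exact ⟨j, fun k hk => by rw [Pi.mul_apply, hi k (h.trans hk), hj k hk, one_mul]⟩
      · exact ⟨i, fun k hk => by rw [Pi.mul_apply, hi k hk, hj k (h.trans hk), one_mul]⟩
    · rintro f g ⟨i, hi⟩ h
      exact ⟨i, fun k hk => le_antisymm (le_one_of_mtl _) ((hi k hk).ge.trans (h k))⟩
  have hb : b ∉ {f : I → A | ∃ i : I, ∀ j : I, (i : A) ≤ j → f j = 1} := by
    rintro ⟨i, hi⟩
    exact i.2 (hi i le_rfl)
  obtain ⟨F, hGF, hmax⟩ := hG.exists_maximal hb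
  have hF := hmax.prop.1
  -- If `a ≠ 1`, the function `j ↦ (a ⇒ j)` is 1 from `a` on, so it lies in `F`; its product with
  -- the constant `a` is below `b`, which would force `b` into `F`.
  have hconst : ∀ a : A, (fun _ : I => a) ∈ F → a = 1 := by
    intro a ha
    by_contra ha1
    refine hmax.prop.2 (hF.mem_of_le (hF.mul_mem ha (hGF (a := res (fun _ => a) b) ?_))
      (mul_res_le _ _))
    exact ⟨⟨a, ha1⟩, fun j hj => res_eq_one_iff.2 hj⟩
  refine ⟨hF.preorder.Quot, inferInstance, hF.isSubdirectlyIrreducible_quot hmax,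
    fun φ hφ => hF.valid_quot (valid_pi hφ), fun s t hst v => ?_⟩
  -- Residua of constants are constant, so `hconst` makes the map from `A` to the quotient
  -- injective.
  have hev : ∀ φ : Formula, φ.eval (fun n (_ : I) => v n) = fun _ => φ.eval v :=
    fun φ => funext fun i => eval_pi_apply _ φ i
  have h := hst fun n => hF.preorder.cls fun _ => v n
  rw [hF.eval_cls, hF.eval_cls, hev, hev] at h
  exact le_antisymm (res_eq_one_iff.1 (hconst _ (hF.cls_le_cls.1 h.le)))
    (res_eq_one_iff.1 (hconst _ (hF.cls_le_cls.1 h.ge)))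

end Power

/-! ### The two implications -/

theorem AxiomaticExtension.SCC.subSCC {L : AxiomaticExtension} (h : SCC.{u} L) :
    SubSCC.{u} L := by
  obtain ⟨A, _, hA, hchain, hcomp⟩ := h
  -- For trivial `A` the index set `A \ {1}` is empty, but `A` itself is then subdirectly
  -- irreducible by convention.
  rcases subsingleton_or_nontrivial A with hs | hn
  · exact ⟨A, _, Or.inl hs, hA, fun s t hst B _ hB => hcomp.satisfiesIdentity hst hB⟩
  · obtain ⟨B, _, hsi, hval, hid⟩ := hchain.exists_isSubdirectlyIrreducible
    exact ⟨B, _, hsi, fun φ hφ => hval φ (hA φ hφ),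
      fun s t hst C _ hC => hcomp.satisfiesIdentity (hid s t hst) hC⟩

theorem AxiomaticExtension.SubSCC.scc {L : AxiomaticExtension} (h : SubSCC.{u} L) :
    SCC.{u} L := by
  obtain ⟨A, _, hsi, hA, hgen⟩ := h
  refine ⟨A, _, hA, hsi.isMTLChain, fun φ => ⟨fun h => h.valid hA, fun h => ?_⟩⟩
  have htop : ∀ {B : Type u} [MTLAlgebra B] (v : ℕ → B),
      (Formula.imp .bot .bot).eval v = 1 := fun v => res_eq_one_iff.2 le_rfl
  -- Validity of `φ` is the identity `φ ≈ (⊥ → ⊥)`, which genericity transfers to the Lindenbaum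
  -- algebra.
  refine provable_of_valid_lindenbaum.{u} fun v => ?_
  rw [hgen φ (.imp .bot .bot) (fun v => (h v).trans (htop v).symm) _ L.isAlgebra_lindenbaum v,
    htop]

end MTL

theorem mainTheorem12 (L : MTL.AxiomaticExtension)
    (hL : MTL.AxiomaticExtension.LocallyFiniteVariety.{u} L) :
    (∃ n : ℕ, 0 < n ∧ L.IsContractive n) ∧
      (MTL.AxiomaticExtension.SCC.{u} L ↔ MTL.AxiomaticExtension.SubSCC.{u} L) :=
  ⟨MTL.exists_isContractive hL, MTL.AxiomaticExtension.SCC.subSCC,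
    MTL.AxiomaticExtension.SubSCC.scc⟩
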